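/- Let $\Omega=[0,1]$ carry the uniform distribution $P$, let $p\in[1,\infty)$, $1/p+1/q=1$, and $\mathcal Z=L_p(\Omega,P)$. For $Z\in\mathcal Z$ let $F_Z(z)=P(Z\le z)$, $F_Z^{-1}(\tau)=\sup\{t:F_Z(t)\le\tau\}$, and, for $\alpha\in[0,1)$, ${\sf AV@R}_\alpha(Z)=\inf_{t\in\mathbb R}\{t+(1-\alpha)^{-1}\mathbb E[Z-t]_+\}$. Let $\mathfrak P$ be the set of probability measures on $[0,1]$ with zero mass at $1$, with the weak topology. For $\rho:\mathcal Z\to\mathbb R$, a set $\mathfrak M\subset\mathfrak P$ is a Kusuoka set of $\rho$ if $\rho(Z)=\sup_{\mu\in\mathfrak M}\int_{[0,1]}{\sf AV@R}_\alpha(Z)\,d\mu(\alpha)$ for all $Z\in\mathcal Z$; it is minimal if it is closed in $\mathfrak P$ and is contained in every Kusuoka set of $\rho$ that is closed in $\mathfrak P$. A spectral function is a nondecreasing right-continuous function $\sigma:[0,1)\to[0,\infty)$ with $\int_0^1\sigma(t)\,dt=1$. For $\mu\in\mathfrak P$ put $(\mathbb T\mu)(\tau)=\int_{[0,\tau]}(1-\alpha)^{-1}\,d\mu(\alpha)$,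 $\tau\in[0,1)$. Let $\sigma$ be a spectral function with $\sigma\in L_q([0,1])$. Then $\sigma F_Z^{-1}$ is integrable for every $Z\in\mathcal Z$, so that $\rho_\sigma(Z)=\int_0^1\sigma(t)F_Z^{-1}(t)\,dt$ is a real-valued functional on $\mathcal Z$. There is exactly one $\mu\in\mathfrak P$ with $\mathbb T\mu=\sigma$, denoted $\mathbb T^{-1}\sigma$; it satisfies $\mu([0,\alpha])=(1-\alpha)\sigma(\alpha)+\int_0^\alpha\sigma(\tau)\,d\tau$ for all $\alpha\in[0,1]$ (the first term being $0$ at $\alpha=1$). The unique minimal Kusuoka set of $\rho_\sigma$ is the singleton $\{\mathbb T^{-1}\sigma\}$. -/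

import Mathlib

open MeasureTheory Set
open scoped ENNReal

noncomputable section

namespace Kusuoka

/-- Distribution function `F_Z(z) = P(Z ≤ z)` of a random variable on the standard probability
space `[0,1]` with the uniform distribution `P`. -/
def cdf (Z : unitInterval → ℝ) (z : ℝ) : ℝ :=
  (volume : Measure unitInterval).real {ω | Z ω ≤ z}

/-- Right side quantile function `F_Z⁻¹(τ) = sup {t : F_Z(t) ≤ τ}`. For `0 < τ < 1` the set is
nonempty and bounded above. -/
def quantile (Z : unitInterval → ℝ) (τ : ℝ) : ℝ :=
  sSup {t : ℝ | cdf Z t ≤ τ}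

/-- Upper Average Value-at-Risk
`AV@R_α(Z) = inf_t { t + (1 - α)⁻¹ E[(Z - t)₊] }`, for `0 ≤ α < 1`. -/
def avar (α : ℝ) (Z : unitInterval → ℝ) : ℝ :=
  ⨅ t : ℝ, t + (1 - α)⁻¹ * ∫ ω : unitInterval, max (Z ω - t) 0

/-- The set `𝔓` of probability measures on `[0,1]` with zero mass at `1`. As a subtype of
`ProbabilityMeasure [0,1]` it carries the weak topology of probability measures. -/
abbrev ProbSet : Type :=
  {μ : ProbabilityMeasure unitInterval // (μ : Measure unitInterval) {1} = 0}

/-- `σ` restricted to `[0,1)` is a spectral function: nonnegative, nondecreasing, right side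
continuous, with `∫₀¹ σ = 1`. Values of `σ` outside `[0,1)` play no role. -/
structure IsSpectral (σ : ℝ → ℝ) : Prop where
  nonneg : ∀ τ ∈ Ico (0 : ℝ) 1, 0 ≤ σ τ
  mono : MonotoneOn σ (Ico (0 : ℝ) 1)
  rightCont : ∀ τ ∈ Ico (0 : ℝ) 1, ContinuousWithinAt σ (Ici τ) τ
  integral_eq_one : ∫ t in Ico (0 : ℝ) 1, σ t = 1

/-- `(𝕋μ)(τ) = ∫_{[0,τ]} (1 - α)⁻¹ dμ(α)`, for `0 ≤ τ < 1`; a possible atom of `μ` at `0`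
counts. -/
def T (μ : ProbSet) (τ : ℝ) : ℝ :=
  ∫ α in {α : unitInterval | (α : ℝ) ≤ τ}, (1 - (α : ℝ))⁻¹ ∂(μ.1 : Measure unitInterval)

/-- The spectral risk measure `ρ_σ(Z) = ∫₀¹ σ(t) F_Z⁻¹(t) dt` on `L_p`. -/
def spectralRisk (p : ℝ≥0∞) (σ : ℝ → ℝ) (Z : Lp ℝ p (volume : Measure unitInterval)) : ℝ :=
  ∫ t in Ico (0 : ℝ) 1, σ t * quantile Z t

/-- `M ⊆ 𝔓` is a Kusuoka set of `ρ : L_p → ℝ` if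
`ρ(Z) = sup_{μ ∈ M} ∫ AV@R_α(Z) dμ(α)` for all `Z ∈ L_p`. Since `AV@R_α(Z) ≥ E[Z]`, every integral
is well defined in `(-∞, ∞]`, and as `ρ(Z)` is real the equation forces all of them to be finite,
which is the integrability clause. -/
def IsKusuokaSet (p : ℝ≥0∞) (ρ : Lp ℝ p (volume : Measure unitInterval) → ℝ) (M : Set ProbSet) : Prop :=
  ∀ Z : Lp ℝ p (volume : Measure unitInterval),
    (∀ μ ∈ M, Integrable (fun α : unitInterval => avar α Z) (μ.1 : Measure unitInterval)) ∧
      IsLUB ((fun μ : ProbSet => ∫ α : unitInterval, avar α Z ∂(μ.1 : Measure unitInterval)) '' M) (ρ Z)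

/-- A Kusuoka set is minimal if it is closed and is contained in every closed Kusuoka set. -/
def IsMinimalKusuokaSet (p : ℝ≥0∞) (ρ : Lp ℝ p (volume : Measure unitInterval) → ℝ)
    (M : Set ProbSet) : Prop :=
  IsKusuokaSet p ρ M ∧ IsClosed M ∧
    ∀ M' : Set ProbSet, IsKusuokaSet p ρ M' → IsClosed M' → M ⊆ M'

end Kusuoka

end

noncomputable section

namespace Kusuoka

open Filter Topology ProbabilityTheory

/-! `AV@R_α(Z)` is the mean of the quantile function over `[α,1)` (`avar_eq`). Fubini with the
kernel `1_{α ≤ t} (1 - α)⁻¹` turns `∫ AV@R_α(Z) dμ` into `∫ 𝕋μ · F_Z⁻¹` (`integral_tailMean`), so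
`𝕋μ = σ` makes `{μ}` a Kusuoka set. Such a `μ` is `(1 - α) dσ(α)`. It is unique because the same
duality, tested on `1_{[0,a)}`, recovers `μ` from `𝕋μ`.

For minimality, let `M` be a closed Kusuoka set and `K` its closure among all probability measures
on `[0,1]`, which is compact. The variables `1_{[s,1]}` show that every `ν ∈ K` has `∫ avarStep s dν
≤ ∫ avarStep s dμ`. The variable `Z(ω) = ω`, whose AV@R is `(1 + α)/2 = ∫₀¹ avarStep s α ds`, gives
equality of the integrals over `s` for some `ν ∈ K`. By continuity equality holds for each `s`;
right derivatives in `s` give `𝕋ν = 𝕋μ`. Letting `s → 1` in the inequality shows that `ν` has no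
mass at `1`, so `μ = ν ∈ M`. -/

/-! ### Distribution and quantile functions. -/

theorem cdf_eq_cdf_map {Z : unitInterval → ℝ} (hZ : AEMeasurable Z) (x : ℝ) :
    cdf Z x = ProbabilityTheory.cdf ((volume : Measure unitInterval).map Z) x := by
  have := Measure.isProbabilityMeasure_map hZ
  rw [ProbabilityTheory.cdf_eq_real, measureReal_def, Measure.map_apply_of_aemeasurable hZ
    measurableSet_Iic]
  rfl

theorem cdf_mono {Z : unitInterval → ℝ} (hZ : AEMeasurable Z) : Monotone (cdf Z) := by
  intro x y h
  rw [cdf_eq_cdf_map hZ, cdf_eq_cdf_map hZ]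
  exact ProbabilityTheory.monotone_cdf _ h

theorem nonempty_cdf_le {Z : unitInterval → ℝ} (hZ : AEMeasurable Z) {τ : ℝ} (hτ : 0 < τ) :
    {t | cdf Z t ≤ τ}.Nonempty := by
  have h := (ProbabilityTheory.tendsto_cdf_atBot
    ((volume : Measure unitInterval).map Z)).eventually (ge_mem_nhds hτ)
  obtain ⟨t, ht⟩ := h.exists
  exact ⟨t, by rwa [mem_ofPred_eq, cdf_eq_cdf_map hZ]⟩

theorem bddAbove_cdf_le {Z : unitInterval → ℝ} (hZ : AEMeasurable Z) {τ : ℝ} (hτ : τ < 1) :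
    BddAbove {t | cdf Z t ≤ τ} := by
  have h := (ProbabilityTheory.tendsto_cdf_atTop
    ((volume : Measure unitInterval).map Z)).eventually (lt_mem_nhds hτ)
  obtain ⟨t, ht⟩ := h.exists
  rw [← cdf_eq_cdf_map hZ] at ht
  refine ⟨t, fun s hs => ?_⟩
  by_contra! hlt
  exact absurd (cdf_mono hZ hlt.le) (not_le.2 (lt_of_le_of_lt hs ht))

/-- With `le_cdf_of_quantile_le` this traps `{τ ∈ (0,1) : F_Z⁻¹(τ) ≤ x}` between `(0, F_Z(x))` and
`[0, F_Z(x)]`, so its length is `F_Z(x)`. -/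
theorem quantile_le_of_lt_cdf {Z : unitInterval → ℝ} (hZ : AEMeasurable Z) {τ x : ℝ} (hτ : 0 < τ)
    (h : τ < cdf Z x) : quantile Z τ ≤ x := by
  refine csSup_le (nonempty_cdf_le hZ hτ) fun t ht => ?_
  by_contra! hlt
  exact absurd (cdf_mono hZ hlt.le) (not_le.2 (lt_of_le_of_lt ht h))

theorem le_cdf_of_quantile_le {Z : unitInterval → ℝ} (hZ : AEMeasurable Z) {τ x : ℝ} (hτ : τ < 1)
    (h : quantile Z τ ≤ x) : τ ≤ cdf Z x := by
  by_contra! hlt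
  have hc := (ProbabilityTheory.cdf ((volume : Measure unitInterval).map Z)).right_continuous x
  rw [cdf_eq_cdf_map hZ] at hlt
  have h1 : ∀ᶠ y in 𝓝[>] x, ProbabilityTheory.cdf ((volume : Measure unitInterval).map Z) y < τ :=
    (hc.tendsto.mono_left (nhdsWithin_mono _ Ioi_subset_Ici_self)).eventually (gt_mem_nhds hlt)
  obtain ⟨y, hy, hxy⟩ := (h1.and self_mem_nhdsWithin).exists
  rw [← cdf_eq_cdf_map hZ] at hy
  exact absurd ((le_csSup (bddAbove_cdf_le hZ hτ) hy.le).trans h) (not_le.2 hxy)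

/-- The endpoints are left out: there the set in the supremum can be empty or unbounded, and `sSup`
then defaults to `0`. -/
theorem monotoneOn_quantile {Z : unitInterval → ℝ} (hZ : AEMeasurable Z) :
    MonotoneOn (quantile Z) (Ioo 0 1) := fun _ hx _ hy hxy =>
  csSup_le_csSup (bddAbove_cdf_le hZ hy.2) (nonempty_cdf_le hZ hx.1) fun _ ht => le_trans ht hxy

theorem restrict_Ico_eq_restrict_Ioo (a b : ℝ) :
    (volume : Measure ℝ).restrict (Ico a b) = volume.restrict (Ioo a b) :=
  Measure.restrict_congr_set Ioo_ae_eq_Ico.symm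

instance : IsProbabilityMeasure ((volume : Measure ℝ).restrict (Ico 0 1)) :=
  ⟨by simp⟩

theorem aemeasurable_of_monotoneOn_Ioo {Q : ℝ → ℝ} (hQ : MonotoneOn Q (Ioo 0 1)) :
    AEMeasurable Q ((volume : Measure ℝ).restrict (Ico 0 1)) := by
  rw [restrict_Ico_eq_restrict_Ioo]
  exact aemeasurable_restrict_of_monotoneOn measurableSet_Ioo hQ

/-- The quantile function has, under Lebesgue measure, the law of the random variable. -/
theorem identDistrib_quantile {Z : unitInterval → ℝ} (hZ : AEMeasurable Z) :
    IdentDistrib Z (quantile Z) volume ((volume : Measure ℝ).restrict (Ico 0 1)) := by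
  have hQ := aemeasurable_of_monotoneOn_Ioo (monotoneOn_quantile hZ)
  refine ⟨hZ, hQ, ?_⟩
  have := Measure.isProbabilityMeasure_map hZ
  have := Measure.isProbabilityMeasure_map hQ
  refine Measure.ext_of_Iic _ _ fun x => ?_
  rw [Measure.map_apply_of_aemeasurable hZ measurableSet_Iic,
    Measure.map_apply_of_aemeasurable hQ measurableSet_Iic]
  have hF : volume (Z ⁻¹' Iic x) = ENNReal.ofReal (cdf Z x) := by
    rw [cdf, ofReal_measureReal]; rfl
  have hF1 : cdf Z x ≤ 1 := measureReal_le_one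
  rw [hF, restrict_Ico_eq_restrict_Ioo, Measure.restrict_apply' measurableSet_Ioo]
  apply le_antisymm
  · calc ENNReal.ofReal (cdf Z x) = volume (Ioo 0 (cdf Z x)) := by simp
      _ ≤ volume (quantile Z ⁻¹' Iic x ∩ Ioo 0 1) := measure_mono fun τ hτ =>
        ⟨quantile_le_of_lt_cdf hZ hτ.1 hτ.2, hτ.1, hτ.2.trans_le hF1⟩
  · calc _ ≤ volume (Icc 0 (cdf Z x)) := measure_mono fun τ hτ =>
          ⟨hτ.2.1.le, le_cdf_of_quantile_le hZ hτ.2.2 hτ.1⟩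
      _ = ENNReal.ofReal (cdf Z x) := by simp

/-! ### Average Value-at-Risk as a tail mean. -/

theorem integral_max_ge {Q : ℝ → ℝ} (hint : IntegrableOn Q (Ico 0 1)) {α : ℝ}
    (hα : α ∈ Ico (0 : ℝ) 1) (t : ℝ) :
    (∫ s in Ico α 1, Q s) - (1 - α) * t ≤ ∫ s in Ico (0 : ℝ) 1, max (Q s - t) 0 := by
  have hsub : Ico α 1 ⊆ Ico 0 1 := Ico_subset_Ico_left hα.1
  have hm : IntegrableOn (fun s => max (Q s - t) 0) (Ico 0 1) :=
    Integrable.pos_part (hint.sub (integrable_const t))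
  have h1 : ∫ s in Ico α 1, (Q s - t) = (∫ s in Ico α 1, Q s) - (1 - α) * t := by
    rw [integral_sub (hint.mono_set hsub) (integrable_const t)]
    simp [hα.2.le]
  rw [← h1]
  refine (integral_mono ((hint.mono_set hsub).sub (integrable_const t)) (hm.mono_set hsub)
    fun s => le_max_left _ _).trans ?_
  exact setIntegral_mono_set hm (Eventually.of_forall fun _ => le_max_right _ _)
    hsub.eventuallyLE

/-- At the level `t = Q α` monotonicity makes the positive part vanish to the left of `α` and
inactive to the right, so the bound of `integral_max_ge` is attained. The value `Q 0` is arbitrary,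
hence `0 < α`. -/
theorem integral_max_eq {Q : ℝ → ℝ} (hQ : MonotoneOn Q (Ioo 0 1))
    (hint : IntegrableOn Q (Ico 0 1)) {α : ℝ} (hα : α ∈ Ioo (0 : ℝ) 1) :
    ∫ s in Ico (0 : ℝ) 1, max (Q s - Q α) 0 = (∫ s in Ico α 1, Q s) - (1 - α) * Q α := by
  have hsub : Ico α 1 ⊆ Ico 0 1 := Ico_subset_Ico_left hα.1.le
  have h1 : ∫ s in Ico α 1, (Q s - Q α) = (∫ s in Ico α 1, Q s) - (1 - α) * Q α := by
    rw [integral_sub (hint.mono_set hsub) (integrable_const _)]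
    simp [hα.2.le]
  rw [← h1, restrict_Ico_eq_restrict_Ioo, ← integral_indicator measurableSet_Ioo,
    ← integral_indicator measurableSet_Ico]
  congr 1
  ext s
  by_cases hs : s ∈ Ioo (0 : ℝ) 1
  · rw [indicator_of_mem hs]
    rcases le_or_gt α s with h | h
    · rw [indicator_of_mem (show s ∈ Ico α 1 from ⟨h, hs.2⟩),
        max_eq_left (sub_nonneg.2 (hQ hα hs h))]
    · rw [indicator_of_notMem (fun h' => absurd h'.1 (not_le.2 h)),
        max_eq_right (sub_nonpos.2 (hQ hs hα h.le))]
  · rw [indicator_of_notMem hs, indicator_of_notMem]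
    exact fun h => hs ⟨hα.1.trans_le h.1, h.2⟩

/-- For `α = 0` the infimum need not be attained and is approached as `t → -∞`: `t + (Q - t)₊ = max
Q t`, dominated by `|Q|` once `t ≤ 0`. -/
theorem tendsto_add_integral_max {Q : ℝ → ℝ} (hint : IntegrableOn Q (Ico 0 1)) :
    Tendsto (fun t : ℝ => t + ∫ s in Ico (0 : ℝ) 1, max (Q s - t) 0) atBot
      (𝓝 (∫ s in Ico (0 : ℝ) 1, Q s)) := by
  have h1 : ∀ t : ℝ, t + ∫ s in Ico (0 : ℝ) 1, max (Q s - t) 0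
      = ∫ s in Ico (0 : ℝ) 1, max (Q s) t := by
    intro t
    have hm : IntegrableOn (fun s => max (Q s - t) 0) (Ico 0 1) :=
      Integrable.pos_part (hint.sub (integrable_const t))
    have : ∫ s in Ico (0 : ℝ) 1, (t + max (Q s - t) 0) =
        t + ∫ s in Ico (0 : ℝ) 1, max (Q s - t) 0 := by
      rw [integral_add (integrable_const t) hm]; simp
    rw [← this]
    congr 1
    ext s
    rw [← max_add_add_left]; simp
  simp_rw [h1]
  refine tendsto_integral_filter_of_dominated_convergence (fun s => |Q s|)
    (Eventually.of_forall fun t =>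
      hint.aestronglyMeasurable.sup aestronglyMeasurable_const) ?_ hint.abs ?_
  · filter_upwards [eventually_le_atBot (0 : ℝ)] with t ht
    refine Eventually.of_forall fun s => ?_
    rw [Real.norm_eq_abs, abs_le]
    exact ⟨(neg_abs_le _).trans (le_max_left _ _), max_le (le_abs_self _) (ht.trans (abs_nonneg _))⟩
  · refine Eventually.of_forall fun s => tendsto_const_nhds.congr' ?_
    filter_upwards [eventually_le_atBot (Q s)] with t ht
    rw [max_eq_left ht]

/-- `AV@R_α(Z) = (1 - α)⁻¹ ∫_α^1 Q`, for a nondecreasing function `Q` on `(0,1)` with the law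
of `Z`. -/
theorem avar_eq {Z : unitInterval → ℝ} {Q : ℝ → ℝ} (hQ : MonotoneOn Q (Ioo 0 1))
    (hint : IntegrableOn Q (Ico 0 1))
    (hZ : IdentDistrib Z Q volume ((volume : Measure ℝ).restrict (Ico 0 1))) {α : ℝ}
    (hα : α ∈ Ico (0 : ℝ) 1) :
    avar α Z = (1 - α)⁻¹ * ∫ t in Ico α 1, Q t := by
  have hpos : 0 < 1 - α := sub_pos.2 hα.2
  have h1 : ∀ t : ℝ, ∫ ω : unitInterval, max (Z ω - t) 0 =
      ∫ s in Ico (0 : ℝ) 1, max (Q s - t) 0 := fun t =>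
    (hZ.comp (u := fun x => max (x - t) 0) (by fun_prop)).integral_eq
  have hge : ∀ t : ℝ, (1 - α)⁻¹ * ∫ s in Ico α 1, Q s ≤
      t + (1 - α)⁻¹ * ∫ s in Ico (0 : ℝ) 1, max (Q s - t) 0 := by
    intro t
    have := mul_le_mul_of_nonneg_left (integral_max_ge hint hα t) (inv_nonneg.2 hpos.le)
    rw [mul_sub, inv_mul_cancel_left₀ hpos.ne'] at this
    linarith
  have hbdd : BddBelow (range fun t : ℝ =>
      t + (1 - α)⁻¹ * ∫ s in Ico (0 : ℝ) 1, max (Q s - t) 0) :=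
    ⟨_, by rintro _ ⟨t, rfl⟩; exact hge t⟩
  simp only [avar, h1]
  refine le_antisymm ?_ (le_ciInf hge)
  rcases hα.1.eq_or_lt with rfl | h0
  · simp only [sub_zero, inv_one, one_mul] at hbdd ⊢
    exact ge_of_tendsto (tendsto_add_integral_max hint)
      (Eventually.of_forall fun t => ciInf_le hbdd t)
  · refine (ciInf_le hbdd (Q α)).trans_eq ?_
    rw [integral_max_eq hQ hint ⟨h0, hα.2⟩, mul_sub, inv_mul_cancel_left₀ hpos.ne']
    ring

/-! ### The operator `𝕋` and its duality with tail means. -/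

theorem ae_lt_one (ν : ProbSet) :
    ∀ᵐ α : unitInterval ∂(ν.1 : Measure unitInterval), (α : ℝ) < 1 := by
  have h : ∀ᵐ α : unitInterval ∂(ν.1 : Measure unitInterval), α ∉ ({1} : Set unitInterval) :=
    measure_eq_zero_iff_ae_notMem.1 ν.2
  filter_upwards [h] with α hα
  exact lt_of_le_of_ne α.2.2 fun h => hα (Subtype.ext h)

theorem measurableSet_coe_le (τ : ℝ) : MeasurableSet {α : unitInterval | (α : ℝ) ≤ τ} :=
  measurableSet_le (by fun_prop) (by fun_prop)

theorem integrableOn_inv_one_sub (ν : ProbSet) {τ : ℝ} (hτ : τ < 1) :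
    IntegrableOn (fun α : unitInterval => (1 - (α : ℝ))⁻¹) {α : unitInterval | (α : ℝ) ≤ τ}
      (ν.1 : Measure unitInterval) := by
  refine Measure.integrableOn_of_bounded (M := (1 - τ)⁻¹) (measure_ne_top _ _)
    (Measurable.aestronglyMeasurable (by fun_prop)) ?_
  filter_upwards [ae_restrict_mem (measurableSet_coe_le τ)] with α hα
  rw [norm_inv, Real.norm_eq_abs, abs_of_nonneg (sub_nonneg.2 α.2.2)]
  exact inv_anti₀ (sub_pos.2 hτ) (sub_le_sub_left hα 1)

theorem T_nonneg (ν : ProbSet) (τ : ℝ) : 0 ≤ T ν τ :=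
  integral_nonneg fun α => inv_nonneg.2 (sub_nonneg.2 α.2.2)

theorem T_monotoneOn (ν : ProbSet) : MonotoneOn (T ν) (Iio 1) := fun _ _ _ hy hxy =>
  setIntegral_mono_set (integrableOn_inv_one_sub ν hy)
    (Eventually.of_forall fun α => inv_nonneg.2 (sub_nonneg.2 α.2.2))
    (Eventually.of_forall fun _ h => le_trans h hxy)

theorem restrict_Ico_restrict_Ici {a b c : ℝ} (h : a ≤ b) :
    ((volume : Measure ℝ).restrict (Ico a c)).restrict (Ici b) = volume.restrict (Ico b c) := by
  rw [Measure.restrict_restrict measurableSet_Ici]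
  congr 1
  ext x
  simp only [mem_inter_iff, mem_Ici, mem_Ico]
  exact ⟨fun h => ⟨h.1, h.2.2⟩, fun h' => ⟨h'.1, h.trans h'.1, h'.2⟩⟩

/-- The kernel `1_{α ≤ t} (1 - α)⁻¹` that represents both `𝕋` and `AV@R`. -/
def kernel (t : ℝ) (α : unitInterval) : ℝ :=
  {x : ℝ × unitInterval | (x.2 : ℝ) ≤ x.1}.indicator (fun x => (1 - (x.2 : ℝ))⁻¹) (t, α)

theorem kernel_nonneg (t : ℝ) (α : unitInterval) : 0 ≤ kernel t α :=
  indicator_nonneg (fun x _ => inv_nonneg.2 (sub_nonneg.2 x.2.2.2)) _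

theorem measurable_kernel : Measurable (Function.uncurry kernel) :=
  Measurable.indicator (by fun_prop) (measurableSet_le (by fun_prop) (by fun_prop))

theorem kernel_eq_indicator (t : ℝ) : kernel t =
    {α : unitInterval | (α : ℝ) ≤ t}.indicator fun α => (1 - (α : ℝ))⁻¹ := rfl

theorem integral_kernel (ν : ProbSet) (t : ℝ) :
    ∫ α, kernel t α ∂(ν.1 : Measure unitInterval) = T ν t := by
  rw [kernel_eq_indicator, integral_indicator (measurableSet_coe_le t), T]

theorem integrable_kernel (ν : ProbSet) {t : ℝ} (ht : t < 1) :
    Integrable (kernel t) (ν.1 : Measure unitInterval) := by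
  rw [kernel_eq_indicator, integrable_indicator_iff (measurableSet_coe_le t)]
  exact integrableOn_inv_one_sub ν ht

theorem integral_kernel_mul (Q : ℝ → ℝ) (α : unitInterval) :
    ∫ t in Ico (0 : ℝ) 1, kernel t α * Q t = (1 - (α : ℝ))⁻¹ * ∫ t in Ico (α : ℝ) 1, Q t := by
  rw [← restrict_Ico_restrict_Ici α.2.1, ← integral_indicator measurableSet_Ici,
    ← integral_const_mul]
  congr 1
  ext t
  by_cases h : (α : ℝ) ≤ t
  · simp [kernel, h]
  · simp [kernel, h]

/-- The kernel is nonnegative, so integrating the norm over `α` gives `𝕋ν |Q|`, which is integrable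
by hypothesis. -/
theorem integrable_kernel_mul (ν : ProbSet) {Q : ℝ → ℝ}
    (hQ : AEStronglyMeasurable Q ((volume : Measure ℝ).restrict (Ico 0 1)))
    (h : IntegrableOn (fun t => T ν t * Q t) (Ico 0 1)) :
    Integrable (Function.uncurry fun t α => kernel t α * Q t)
      (((volume : Measure ℝ).restrict (Ico 0 1)).prod (ν.1 : Measure unitInterval)) := by
  have hm : AEStronglyMeasurable (Function.uncurry fun t α => kernel t α * Q t)
      (((volume : Measure ℝ).restrict (Ico 0 1)).prod (ν.1 : Measure unitInterval)) :=
    measurable_kernel.aestronglyMeasurable.mul hQ.comp_fst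
  refine (integrable_prod_iff hm).2 ⟨?_, ?_⟩
  · filter_upwards [ae_restrict_mem measurableSet_Ico] with t ht
    exact (integrable_kernel ν ht.2).mul_const (Q t)
  · refine h.norm.congr (Eventually.of_forall fun t => ?_)
    simp only [Function.uncurry, norm_mul, Real.norm_eq_abs, abs_of_nonneg (kernel_nonneg _ _),
      abs_of_nonneg (T_nonneg ν t)]
    rw [integral_mul_const, integral_kernel]

theorem integrable_tailMean (ν : ProbSet) {Q : ℝ → ℝ}
    (hQ : AEStronglyMeasurable Q ((volume : Measure ℝ).restrict (Ico 0 1)))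
    (h : IntegrableOn (fun t => T ν t * Q t) (Ico 0 1)) :
    Integrable (fun α : unitInterval => (1 - (α : ℝ))⁻¹ * ∫ t in Ico (α : ℝ) 1, Q t)
      (ν.1 : Measure unitInterval) := by
  simpa only [Function.uncurry, integral_kernel_mul] using
    (integrable_kernel_mul ν hQ h).integral_prod_right

/-- Duality between `𝕋` and tail means. -/
theorem integral_tailMean (ν : ProbSet) {Q : ℝ → ℝ}
    (hQ : AEStronglyMeasurable Q ((volume : Measure ℝ).restrict (Ico 0 1)))
    (h : IntegrableOn (fun t => T ν t * Q t) (Ico 0 1)) :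
    ∫ α : unitInterval, (1 - (α : ℝ))⁻¹ * (∫ t in Ico (α : ℝ) 1, Q t)
      ∂(ν.1 : Measure unitInterval) = ∫ t in Ico (0 : ℝ) 1, T ν t * Q t := by
  simpa only [integral_kernel_mul, integral_mul_const, integral_kernel] using
    (integral_integral_swap (integrable_kernel_mul ν hQ h)).symm

theorem integrableOn_T_Ico (ν : ProbSet) {a : ℝ} (ha : a < 1) : IntegrableOn (T ν) (Ico 0 a) :=
  (((T_monotoneOn ν).mono (fun _ hx => lt_of_le_of_lt hx.2 ha)).integrableOn_isCompact
    isCompact_Icc).mono_set Ico_subset_Icc_self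

/-- The distribution function of `ν` in terms of `𝕋ν`. -/
theorem measureReal_Iic_eq (ν : ProbSet) {a : unitInterval} (ha : (a : ℝ) < 1) :
    (ν.1 : Measure unitInterval).real (Iic a) =
      (1 - (a : ℝ)) * T ν a + ∫ t in Ico (0 : ℝ) a, T ν t := by
  have hsub : Ico (0 : ℝ) a ⊆ Ico 0 1 := Ico_subset_Ico_right ha.le
  -- The tail integral of this `Q` is `(a - α)₊`, and `(1 - α)⁻¹ (1 - a) + (1 - α)⁻¹ (a - α) = 1`
  -- for `α ≤ a`.
  set Q : ℝ → ℝ := (Ico (0 : ℝ) a).indicator 1 with hQdef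
  have hTQ : (fun t => T ν t * Q t) = (Ico (0 : ℝ) a).indicator (T ν) := by
    ext t
    by_cases h : t ∈ Ico (0 : ℝ) a <;> simp [Q, h]
  have hint : IntegrableOn (fun t => T ν t * Q t) (Ico 0 1) := by
    rw [hTQ]
    exact ((integrable_indicator_iff measurableSet_Ico).2 (integrableOn_T_Ico ν ha)).integrableOn
  have hQm : Measurable Q := measurable_one.indicator measurableSet_Ico
  have h := integral_tailMean ν hQm.aestronglyMeasurable hint
  have htail : ∀ α : unitInterval, (1 - (α : ℝ))⁻¹ * ∫ t in Ico (α : ℝ) 1, Q t =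
      {α : unitInterval | (α : ℝ) ≤ a}.indicator
        (fun α => (1 - (α : ℝ))⁻¹ * (a - α)) α := by
    intro α
    have : ∫ t in Ico (α : ℝ) 1, Q t = max ((a : ℝ) - α) 0 := by
      rw [hQdef, integral_indicator_one measurableSet_Ico, measureReal_restrict_apply
        measurableSet_Ico, Ico_inter_Ico, sup_eq_right.2 α.2.1, inf_eq_left.2 ha.le,
        measureReal_def, Real.volume_Ico, ENNReal.toReal_ofReal']
    rw [this]
    by_cases hα : (α : ℝ) ≤ a
    · rw [indicator_of_mem (show α ∈ {α : unitInterval | (α : ℝ) ≤ a} from hα),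
        max_eq_left (sub_nonneg.2 hα)]
    · rw [indicator_of_notMem (show α ∉ {α : unitInterval | (α : ℝ) ≤ a} from hα),
        max_eq_right (sub_nonpos.2 (not_le.1 hα).le), mul_zero]
  have hI : IntegrableOn (fun α : unitInterval => (1 - (α : ℝ))⁻¹ * ((a : ℝ) - α))
      {α : unitInterval | (α : ℝ) ≤ a} (ν.1 : Measure unitInterval) := by
    rw [← integrable_indicator_iff (measurableSet_coe_le _)]
    exact (integrable_tailMean ν hQm.aestronglyMeasurable hint).congr (Eventually.of_forall htail)
  simp_rw [htail, hTQ] at h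
  rw [integral_indicator (measurableSet_coe_le _), integral_indicator measurableSet_Ico,
    Measure.restrict_restrict measurableSet_Ico, inter_eq_left.2 hsub] at h
  rw [← h, T, ← integral_const_mul, ← integral_add
    ((integrableOn_inv_one_sub ν ha).const_mul _) hI, ← integral_indicator_one measurableSet_Iic,
    ← integral_indicator (measurableSet_coe_le _)]
  congr 1
  ext α
  by_cases hα : (α : ℝ) ≤ a
  · have : (1 - (α : ℝ)) ≠ 0 := (sub_pos.2 (hα.trans_lt ha)).ne'
    rw [indicator_of_mem (show α ∈ Iic a from hα),
      indicator_of_mem (show α ∈ {α : unitInterval | (α : ℝ) ≤ a} from hα)]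
    simp only [Pi.one_apply]
    field_simp
    ring
  · rw [indicator_of_notMem (show α ∉ Iic a from hα),
      indicator_of_notMem (show α ∉ {α : unitInterval | (α : ℝ) ≤ a} from hα)]

/-- `𝕋` is injective on `𝔓`. -/
theorem eq_of_eqOn_T {ν μ : ProbSet} (h : EqOn (T ν) (T μ) (Ico 0 1)) : ν = μ := by
  suffices (ν.1 : Measure unitInterval) = μ.1 from Subtype.ext (Subtype.ext this)
  refine Measure.ext_of_Iic _ _ fun a => ?_
  rcases a.2.2.eq_or_lt with ha | ha
  · have : Iic a = univ := eq_univ_of_forall fun x => by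
      rw [mem_Iic, ← Subtype.coe_le_coe, ha]; exact x.2.2
    rw [this]
    rw [measure_univ, measure_univ]
  · rw [← measureReal_eq_measureReal_iff]
    have h1 := measureReal_Iic_eq ν ha
    have h2 := measureReal_Iic_eq μ ha
    rw [h ⟨a.2.1, ha⟩, setIntegral_congr_fun measurableSet_Ico
      (h.mono (Ico_subset_Ico_right ha.le)), ← h2] at h1
    exact h1

/-! ### Construction of `𝕋⁻¹σ`. -/

theorem IsSpectral.aemeasurable {σ : ℝ → ℝ} (hσ : IsSpectral σ) :
    AEMeasurable σ ((volume : Measure ℝ).restrict (Ico 0 1)) :=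
  aemeasurable_restrict_of_monotoneOn measurableSet_Ico hσ.mono

theorem IsSpectral.integrableOn {σ : ℝ → ℝ} (hσ : IsSpectral σ) : IntegrableOn σ (Ico 0 1) := by
  by_contra h
  exact zero_ne_one ((integral_undef h).symm.trans hσ.integral_eq_one)

theorem IsSpectral.lintegral_eq_one {σ : ℝ → ℝ} (hσ : IsSpectral σ) :
    ∫⁻ t in Ico (0 : ℝ) 1, ENNReal.ofReal (σ t) = 1 := by
  rw [← ofReal_integral_eq_lintegral_ofReal hσ.integrableOn, hσ.integral_eq_one, ENNReal.ofReal_one]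
  filter_upwards [ae_restrict_mem measurableSet_Ico] with t ht using hσ.nonneg t ht

/-- The left-continuous inverse `y ↦ inf {t : y ≤ σ(t)}` of a spectral function, with value `1`
where the set is empty. -/
def spectralInv (σ : ℝ → ℝ) (y : ℝ) : unitInterval :=
  ⟨sInf {t : ℝ | t ∈ Icc 0 1 ∧ (t = 1 ∨ y ≤ σ t)},
    le_csInf ⟨1, ⟨zero_le_one, le_rfl⟩, Or.inl rfl⟩ fun _ ht => ht.1.1,
    csInf_le ⟨0, fun _ ht => ht.1.1⟩ ⟨⟨zero_le_one, le_rfl⟩, Or.inl rfl⟩⟩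

/-- Right continuity of `σ` makes the infimum attained, when it is less than `1`. -/
theorem IsSpectral.spectralInv_le_iff {σ : ℝ → ℝ} (hσ : IsSpectral σ) {y a : ℝ}
    (ha : a ∈ Ico (0 : ℝ) 1) : (spectralInv σ y : ℝ) ≤ a ↔ y ≤ σ a := by
  constructor
  · intro h
    by_contra! hlt
    have h1 : ∀ᶠ t in 𝓝[≥] a, σ t < y := (hσ.rightCont a ha).eventually (gt_mem_nhds hlt)
    obtain ⟨b, hab, hb⟩ := (mem_nhdsGE_iff_exists_Ico_subset' ha.2).1 h1
    have hb' : min b 1 ≤ (spectralInv σ y : ℝ) := by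
      refine le_csInf ⟨1, ⟨zero_le_one, le_rfl⟩, Or.inl rfl⟩ fun t ht => ?_
      by_contra! htb
      rcases ht.2 with rfl | hy
      · exact absurd htb (not_lt.2 (min_le_right _ _))
      · rcases le_total a t with hat | hta
        · exact absurd hy (not_le.2 (hb ⟨hat, htb.trans_le (min_le_left _ _)⟩))
        · exact absurd (hy.trans (hσ.mono ⟨ht.1.1, hta.trans_lt ha.2⟩ ha hta)) (not_le.2 hlt)
    exact absurd (hb'.trans h) (not_le.2 (lt_min hab ha.2))
  · intro h
    exact csInf_le ⟨0, fun _ ht => ht.1.1⟩ ⟨⟨ha.1, ha.2.le⟩, Or.inr h⟩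

theorem monotone_spectralInv (σ : ℝ → ℝ) : Monotone (spectralInv σ) := fun x y h =>
  show (spectralInv σ x : ℝ) ≤ spectralInv σ y from csInf_le_csInf ⟨0, fun _ ht => ht.1.1⟩ ⟨1, ⟨zero_le_one, le_rfl⟩, Or.inl rfl⟩
    fun _ ht => ⟨ht.1, ht.2.imp_right h.trans⟩

theorem measurable_spectralInv (σ : ℝ → ℝ) : Measurable (spectralInv σ) :=
  (monotone_spectralInv σ).measurable

/-- The Lebesgue–Stieltjes measure of a spectral function on `[0,1)`, with mass `σ(0)` at `0`. -/
def spectralStieltjes (σ : ℝ → ℝ) : Measure unitInterval :=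
  ((volume : Measure ℝ).restrict (Ioi 0)).map (spectralInv σ)

theorem IsSpectral.spectralStieltjes_le {σ : ℝ → ℝ} (hσ : IsSpectral σ) {τ : ℝ}
    (hτ : τ ∈ Ico (0 : ℝ) 1) :
    spectralStieltjes σ {α : unitInterval | (α : ℝ) ≤ τ} = ENNReal.ofReal (σ τ) := by
  rw [spectralStieltjes, Measure.map_apply (measurable_spectralInv σ) (measurableSet_coe_le τ),
    Measure.restrict_apply (measurable_spectralInv σ (measurableSet_coe_le τ))]
  have : spectralInv σ ⁻¹' {α : unitInterval | (α : ℝ) ≤ τ} ∩ Ioi 0 = Ioc 0 (σ τ) := by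
    ext y
    simp only [mem_inter_iff, mem_preimage, mem_ofPred_eq, mem_Ioi, mem_Ioc,
      hσ.spectralInv_le_iff hτ]
    exact and_comm
  rw [this, Real.volume_Ioc, sub_zero]

/-- The measure `(1 - α) dσ(α)`. -/
def spectralMeasure (σ : ℝ → ℝ) : Measure unitInterval :=
  (spectralStieltjes σ).withDensity fun α => ENNReal.ofReal (1 - (α : ℝ))

/-- Layer-cake formula: `{t : y ≤ σ t}` has length `1 - spectralInv σ y`, so the total mass is `∫ σ
= 1`. -/
theorem IsSpectral.isProbabilityMeasure {σ : ℝ → ℝ} (hσ : IsSpectral σ) :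
    IsProbabilityMeasure (spectralMeasure σ) := by
  constructor
  rw [spectralMeasure, withDensity_apply _ MeasurableSet.univ, Measure.restrict_univ,
    spectralStieltjes, lintegral_map (by fun_prop) (measurable_spectralInv σ),
    ← hσ.lintegral_eq_one, lintegral_eq_lintegral_meas_le _ _ hσ.aemeasurable]
  · refine lintegral_congr fun y => ?_
    rw [Measure.restrict_apply' measurableSet_Ico]
    have : {t | y ≤ σ t} ∩ Ico 0 1 = Ico (spectralInv σ y : ℝ) 1 := by
      ext t
      simp only [mem_inter_iff, mem_ofPred_eq]
      refine ⟨fun h => ⟨(hσ.spectralInv_le_iff h.2).2 h.1, h.2.2⟩, fun h => ?_⟩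
      have ht : t ∈ Ico (0 : ℝ) 1 := ⟨(spectralInv σ y).2.1.trans h.1, h.2⟩
      exact ⟨(hσ.spectralInv_le_iff ht).1 h.1, ht⟩
    rw [this, Real.volume_Ico]
  · filter_upwards [ae_restrict_mem measurableSet_Ico] with t ht using hσ.nonneg t ht

/-- For bounded `σ` the Stieltjes measure has infinite mass at `1`, but the density vanishes there.
-/
theorem spectralMeasure_singleton_one (σ : ℝ → ℝ) : spectralMeasure σ {1} = 0 := by
  rw [spectralMeasure, withDensity_apply _ (measurableSet_singleton _)]
  refine (setLIntegral_congr_fun (measurableSet_singleton _) (g := fun _ => 0) ?_).trans (by simp)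
  rintro α rfl
  simp

/-- `𝕋⁻¹σ`. -/
def IsSpectral.invT {σ : ℝ → ℝ} (hσ : IsSpectral σ) : ProbSet :=
  ⟨⟨spectralMeasure σ, hσ.isProbabilityMeasure⟩, spectralMeasure_singleton_one σ⟩

/-- On `[0,τ]` with `τ < 1` the factors `1 - α` and `(1 - α)⁻¹` cancel, leaving the Stieltjes mass
`σ(τ)`. -/
theorem IsSpectral.T_invT {σ : ℝ → ℝ} (hσ : IsSpectral σ) : EqOn (T hσ.invT) σ (Ico 0 1) := by
  intro τ hτ
  have h : T hσ.invT τ = ∫ α in {α : unitInterval | (α : ℝ) ≤ τ}, (1 - (α : ℝ))⁻¹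
      ∂(spectralMeasure σ) := rfl
  rw [h, integral_eq_lintegral_of_nonneg_ae
    (Eventually.of_forall fun α => inv_nonneg.2 (sub_nonneg.2 α.2.2))
    (Measurable.aestronglyMeasurable (by fun_prop)), spectralMeasure,
    setLIntegral_withDensity_eq_setLIntegral_mul _ (by fun_prop) (by fun_prop)
      (measurableSet_coe_le τ)]
  have h1 : ∫⁻ α in {α : unitInterval | (α : ℝ) ≤ τ},
      ((fun α : unitInterval => ENNReal.ofReal (1 - (α : ℝ))) *
        fun α : unitInterval => ENNReal.ofReal (1 - (α : ℝ))⁻¹) α ∂(spectralStieltjes σ) =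
      ∫⁻ α in {α : unitInterval | (α : ℝ) ≤ τ}, 1 ∂(spectralStieltjes σ) := by
    refine setLIntegral_congr_fun (measurableSet_coe_le τ) fun α hα => ?_
    have hpos : 0 < 1 - (α : ℝ) := sub_pos.2 (lt_of_le_of_lt hα hτ.2)
    rw [Pi.mul_apply, ← ENNReal.ofReal_mul hpos.le, mul_inv_cancel₀ hpos.ne', ENNReal.ofReal_one]
  rw [h1, setLIntegral_one, hσ.spectralStieltjes_le hτ, ENNReal.toReal_ofReal (hσ.nonneg τ hτ)]

theorem IsSpectral.invT_real_Iic {σ : ℝ → ℝ} (hσ : IsSpectral σ) (α : unitInterval) :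
    (hσ.invT.1 : Measure unitInterval).real (Iic α) =
      (1 - (α : ℝ)) * σ α + ∫ t in Ico (0 : ℝ) (α : ℝ), σ t := by
  rcases α.2.2.eq_or_lt with ha | ha
  · have : Iic α = univ := eq_univ_of_forall fun x => by
      rw [mem_Iic, ← Subtype.coe_le_coe, ha]; exact x.2.2
    rw [this, ha, hσ.integral_eq_one, probReal_univ]
    ring
  · rw [measureReal_Iic_eq _ ha, hσ.T_invT ⟨α.2.1, ha⟩, setIntegral_congr_fun measurableSet_Ico
      (hσ.T_invT.mono (Ico_subset_Ico_right ha.le))]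

/-! ### Kusuoka representation of `ρ_σ`. -/

theorem memLp_quantile {p : ℝ≥0∞} (Z : Lp ℝ p (volume : Measure unitInterval)) :
    MemLp (quantile Z) p ((volume : Measure ℝ).restrict (Ico 0 1)) :=
  (identDistrib_quantile (Lp.aestronglyMeasurable Z).aemeasurable).memLp_iff.1 (Lp.memLp Z)

theorem integrableOn_mul_quantile {p q : ℝ≥0∞} (hpq : p⁻¹ + q⁻¹ = 1) {σ : ℝ → ℝ}
    (hσq : MemLp σ q ((volume : Measure ℝ).restrict (Ico (0 : ℝ) 1)))
    (Z : Lp ℝ p (volume : Measure unitInterval)) :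
    IntegrableOn (fun t => σ t * quantile Z t) (Ico (0 : ℝ) 1) := by
  have : ENNReal.HolderConjugate q p := ENNReal.holderConjugate_iff.2 (by rwa [add_comm])
  exact hσq.integrable_mul (memLp_quantile Z)

/-- `ρ_σ` is represented by any `μ` with `𝕋μ = σ`. -/
theorem isKusuokaSet_singleton {p q : ℝ≥0∞} (hp : 1 ≤ p) (hpq : p⁻¹ + q⁻¹ = 1) {σ : ℝ → ℝ}
    (hσq : MemLp σ q ((volume : Measure ℝ).restrict (Ico (0 : ℝ) 1))) {μ : ProbSet}
    (hμ : EqOn (T μ) σ (Ico 0 1)) : IsKusuokaSet p (spectralRisk p σ) {μ} := by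
  intro Z
  have hZ := (Lp.aestronglyMeasurable Z).aemeasurable
  have hQ := memLp_quantile Z
  have hEq : EqOn (fun t => T μ t * quantile Z t) (fun t => σ t * quantile Z t) (Ico 0 1) :=
    fun t ht => by simp only [hμ ht]
  have hint : IntegrableOn (fun t => T μ t * quantile Z t) (Ico 0 1) :=
    (integrableOn_mul_quantile hpq hσq Z).congr_fun hEq.symm measurableSet_Ico
  have hae : (fun α : unitInterval => avar α Z) =ᵐ[(μ.1 : Measure unitInterval)]
      fun α : unitInterval => (1 - (α : ℝ))⁻¹ * ∫ t in Ico (α : ℝ) 1, quantile Z t := by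
    filter_upwards [ae_lt_one μ] with α hα
    exact avar_eq (monotoneOn_quantile hZ) (hQ.integrable hp) (identDistrib_quantile hZ)
      ⟨α.2.1, hα⟩
  constructor
  · rintro ν rfl
    exact (integrable_tailMean ν hQ.1 hint).congr hae.symm
  · rw [image_singleton, integral_congr_ae hae, integral_tailMean μ hQ.1 hint,
      setIntegral_congr_fun measurableSet_Ico hEq]
    exact isLUB_singleton

/-! ### Bounded test variables and step functions. -/

/-- The coordinate `ω` is uniform, so `Z = Q(ω)` has the law of `Q`; boundedness puts it in every
`L_p`. -/
theorem exists_avar_eq (p : ℝ≥0∞) {Q : ℝ → ℝ} (hQ : Monotone Q) {C : ℝ}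
    (hC : ∀ t ∈ Icc (0 : ℝ) 1, |Q t| ≤ C) :
    ∃ Z : Lp ℝ p (volume : Measure unitInterval), ∀ α ∈ Ico (0 : ℝ) 1,
      avar α Z = (1 - α)⁻¹ * ∫ t in Ico α 1, Q t := by
  have hmem : MemLp (fun ω : unitInterval => Q ω) p volume :=
    MemLp.of_bound (hQ.measurable.comp measurable_subtype_coe).aestronglyMeasurable C
      (Eventually.of_forall fun ω => hC ω ω.2)
  have hint : IntegrableOn Q (Ico 0 1) :=
    ((hQ.monotoneOn _).integrableOn_isCompact isCompact_Icc).mono_set Ico_subset_Icc_self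
  refine ⟨hmem.toLp _, fun α hα => avar_eq (hQ.monotoneOn _) hint ?_ hα⟩
  have h1 : IdentDistrib (fun ω : unitInterval => (ω : ℝ)) id volume
      ((volume : Measure ℝ).restrict (Ico 0 1)) := by
    refine ⟨by fun_prop, by fun_prop, ?_⟩
    rw [unitInterval.measurePreserving_coe.map_eq, Measure.map_id,
      Measure.restrict_congr_set Ico_ae_eq_Icc]
  exact (IdentDistrib.of_ae_eq (Lp.aestronglyMeasurable _).aemeasurable hmem.coeFn_toLp).trans
    (h1.comp hQ.measurable)

/-- The map `(s, α) ↦ AV@R_α(1_{[s,1]})`, extended continuously to `α = 1`. -/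
def avarStep (s : ℝ) (α : unitInterval) : ℝ := (1 - s) / (1 - min s α)

theorem avarStep_of_le {s : ℝ} {α : unitInterval} (h : (α : ℝ) ≤ s) :
    avarStep s α = (1 - s) / (1 - α) := by rw [avarStep, min_eq_right h]

theorem avarStep_of_ge {s : ℝ} {α : unitInterval} (hs : s < 1) (h : s ≤ (α : ℝ)) :
    avarStep s α = 1 := by rw [avarStep, min_eq_left h, div_self (sub_pos.2 hs).ne']

theorem avarStep_nonneg {s : ℝ} (hs : s ≤ 1) (α : unitInterval) : 0 ≤ avarStep s α :=
  div_nonneg (sub_nonneg.2 hs) (sub_nonneg.2 ((min_le_left _ _).trans hs))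

theorem avarStep_le_one {s : ℝ} (hs : s ≤ 1) (α : unitInterval) : avarStep s α ≤ 1 :=
  div_le_one_of_le₀ (sub_le_sub_left (min_le_left _ _) 1)
    (sub_nonneg.2 ((min_le_left _ _).trans hs))

theorem norm_avarStep_le {s : ℝ} (hs : s ≤ 1) (α : unitInterval) : ‖avarStep s α‖ ≤ 1 := by
  rw [Real.norm_eq_abs, abs_of_nonneg (avarStep_nonneg hs α)]
  exact avarStep_le_one hs α

theorem measurable_avarStep : Measurable (Function.uncurry avarStep) := by
  unfold avarStep Function.uncurry
  fun_prop

theorem continuous_avarStep {s : ℝ} (hs : s < 1) : Continuous (avarStep s) :=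
  continuous_const.div (by fun_prop) fun _ =>
    (sub_pos.2 ((min_le_left _ _).trans_lt hs)).ne'

theorem integrable_avarStep (ν : ProbabilityMeasure unitInterval) {s : ℝ} (hs : s ≤ 1) :
    Integrable (avarStep s) (ν : Measure unitInterval) :=
  Integrable.of_bound (measurable_avarStep.of_uncurry_left).aestronglyMeasurable 1
    (Eventually.of_forall (norm_avarStep_le hs))

/-- Absence of mass at `1` matters at `s = 1`: `avarStep s 1` is `1` for `s < 1` but `0/0 = 0` at `s
= 1`. -/
theorem continuousOn_integral_avarStep (ν : ProbSet) :
    ContinuousOn (fun s => ∫ α, avarStep s α ∂(ν.1 : Measure unitInterval)) (Iic 1) := by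
  refine continuousOn_of_dominated (bound := fun _ => 1)
    (fun s _ => (measurable_avarStep.of_uncurry_left).aestronglyMeasurable)
    (fun s hs => Eventually.of_forall (norm_avarStep_le hs)) (integrable_const _) ?_
  filter_upwards [ae_lt_one ν] with α hα
  exact ((by fun_prop : Continuous fun s : ℝ => 1 - s).div (by fun_prop) fun s =>
    (sub_pos.2 ((min_le_right s _).trans_lt hα)).ne').continuousOn

theorem integral_avarStep_left {α : unitInterval} (hα : (α : ℝ) < 1) :
    ∫ s in Ico (0 : ℝ) 1, avarStep s α = (1 + (α : ℝ)) / 2 := by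
  have hpos : 0 < 1 - (α : ℝ) := sub_pos.2 hα
  have hc : Continuous fun s : ℝ => avarStep s α :=
    (by fun_prop : Continuous fun s : ℝ => 1 - s).div (by fun_prop) fun s =>
      (sub_pos.2 ((min_le_right s _).trans_lt hα)).ne'
  rw [integral_Ico_eq_integral_Ioc, ← intervalIntegral.integral_of_le zero_le_one,
    ← intervalIntegral.integral_add_adjacent_intervals (b := (α : ℝ))
      (hc.intervalIntegrable _ _) (hc.intervalIntegrable _ _)]
  have h1 : ∫ s in (0 : ℝ)..α, avarStep s α = ∫ s in (0 : ℝ)..α, (1 : ℝ) :=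
    intervalIntegral.integral_congr fun s hs => by
      rw [uIcc_of_le α.2.1] at hs
      exact avarStep_of_ge (hs.2.trans_lt hα) hs.2
  have h2 : ∫ s in (α : ℝ)..1, avarStep s α = ∫ s in (α : ℝ)..1, (1 - s) / (1 - α) :=
    intervalIntegral.integral_congr fun s hs => by
      rw [uIcc_of_le α.2.2] at hs
      exact avarStep_of_le hs.1
  rw [h1, h2, intervalIntegral.integral_div, intervalIntegral.integral_sub
    intervalIntegrable_const intervalIntegral.intervalIntegrable_id]
  simp only [intervalIntegral.integral_const, integral_id, smul_eq_mul]
  field_simp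
  ring

theorem integral_integral_avarStep (ν : ProbSet) :
    ∫ s in Ico (0 : ℝ) 1, (∫ α, avarStep s α ∂(ν.1 : Measure unitInterval)) =
      ∫ α : unitInterval, (1 + (α : ℝ)) / 2 ∂(ν.1 : Measure unitInterval) := by
  rw [integral_integral_swap]
  · refine integral_congr_ae ?_
    filter_upwards [ae_lt_one ν] with α hα using integral_avarStep_left hα
  · refine Integrable.of_bound measurable_avarStep.aestronglyMeasurable 1 ?_
    have : ∀ᵐ s ∂((volume : Measure ℝ).restrict (Ico 0 1)), s ≤ 1 := by
      filter_upwards [ae_restrict_mem measurableSet_Ico] with s hs using hs.2.le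
    filter_upwards [Measure.quasiMeasurePreserving_fst.ae this] with x hx
    exact norm_avarStep_le hx x.2

/-- A bound uniform in `α`, to dominate the difference quotients under the integral. -/
theorem abs_slope_avarStep_le {s r : ℝ} (hsr : s < r) (hr : r < 1) (α : unitInterval) :
    |(avarStep s α - avarStep r α) / (r - s)| ≤ (1 - r)⁻¹ := by
  have h0 : 0 < r - s := sub_pos.2 hsr
  have h1 : 0 < 1 - r := sub_pos.2 hr
  rcases le_total (α : ℝ) r with hαr | hαr
  · have h2 : 0 < 1 - (α : ℝ) := by linarith
    rw [avarStep_of_le hαr]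
    have hle : (1 - (α : ℝ))⁻¹ ≤ (1 - r)⁻¹ := inv_anti₀ h1 (by linarith)
    rcases le_total (α : ℝ) s with hαs | hαs
    · rw [avarStep_of_le hαs]
      have : ((1 - s) / (1 - (α : ℝ)) - (1 - r) / (1 - α)) / (r - s) = (1 - (α : ℝ))⁻¹ := by
        field_simp
        ring
      rwa [this, abs_of_nonneg (inv_nonneg.2 h2.le)]
    · rw [avarStep_of_ge (hsr.trans hr) hαs]
      have : (1 - (1 - r) / (1 - (α : ℝ))) / (r - s) = (1 - (α : ℝ))⁻¹ * ((r - α) / (r - s)) := by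
        field_simp
        ring
      rw [this, abs_of_nonneg (mul_nonneg (inv_nonneg.2 h2.le)
        (div_nonneg (sub_nonneg.2 hαr) h0.le))]
      exact (mul_le_of_le_one_right (inv_nonneg.2 h2.le)
        ((div_le_one h0).2 (by linarith))).trans hle
  · rw [avarStep_of_ge hr hαr, avarStep_of_ge (hsr.trans hr) (hsr.le.trans hαr)]
    simpa using h1.le

/-- `𝕋ν` is minus the right derivative of `s ↦ ∫ AV@R_α(1_{[s,1]}) dν(α)`. -/
theorem tendsto_slope_integral_avarStep (ν : ProbSet) {s : ℝ} (hs : s < 1) :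
    Tendsto (fun r => ((∫ α, avarStep s α ∂(ν.1 : Measure unitInterval)) -
      ∫ α, avarStep r α ∂(ν.1 : Measure unitInterval)) / (r - s)) (𝓝[>] s) (𝓝 (T ν s)) := by
  -- Keeping `r` below this midpoint bounds `(1 - r)⁻¹` uniformly.
  have hmid : s < (s + 1) / 2 := by linarith
  have hev : ∀ᶠ r in 𝓝[>] s, r ∈ Ioo s ((s + 1) / 2) := Ioo_mem_nhdsGT hmid
  have hlim : Tendsto (fun r => ∫ α, (avarStep s α - avarStep r α) / (r - s)
      ∂(ν.1 : Measure unitInterval)) (𝓝[>] s) (𝓝 (T ν s)) := by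
    rw [← integral_kernel]
    refine tendsto_integral_filter_of_dominated_convergence (fun _ => (1 - (s + 1) / 2)⁻¹)
      (Eventually.of_forall fun r => ((measurable_avarStep.of_uncurry_left.sub
        measurable_avarStep.of_uncurry_left).div_const _).aestronglyMeasurable) ?_
      (integrable_const _) (Eventually.of_forall fun α => ?_)
    · filter_upwards [hev] with r hr
      refine Eventually.of_forall fun α => ?_
      refine (abs_slope_avarStep_le hr.1 (by linarith [hr.2]) α).trans ?_
      exact inv_anti₀ (by linarith) (by linarith [hr.2])
    · refine tendsto_const_nhds.congr' ?_
      rw [kernel_eq_indicator]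
      rcases le_or_gt (α : ℝ) s with h | h
      · filter_upwards [hev] with r hr
        have h0 : r - s ≠ 0 := (sub_pos.2 hr.1).ne'
        have h2 : 1 - (α : ℝ) ≠ 0 := by linarith
        rw [indicator_of_mem (show α ∈ {α : unitInterval | (α : ℝ) ≤ s} from h),
          avarStep_of_le h, avarStep_of_le (h.trans hr.1.le)]
        field_simp
        ring
      · filter_upwards [hev, Ioo_mem_nhdsGT h] with r hr hrα
        rw [indicator_of_notMem (show α ∉ {α : unitInterval | (α : ℝ) ≤ s} from not_le.2 h),
          avarStep_of_ge hs h.le, avarStep_of_ge (by linarith [hr.2]) hrα.2.le]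
        simp
  refine hlim.congr' ?_
  filter_upwards [hev] with r hr
  rw [integral_div, integral_sub (integrable_avarStep _ hs.le)
    (integrable_avarStep _ (by linarith [hr.2]))]

/-- Elements of `𝔓` are equal if one dominates the other on the step functions and both agree on
the identity. -/
theorem eq_of_integral_avarStep_le {ν μ : ProbSet}
    (hle : ∀ s ∈ Ico (0 : ℝ) 1, ∫ α, avarStep s α ∂(ν.1 : Measure unitInterval) ≤
      ∫ α, avarStep s α ∂(μ.1 : Measure unitInterval))
    (heq : ∫ α : unitInterval, (1 + (α : ℝ)) / 2 ∂(ν.1 : Measure unitInterval) =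
      ∫ α : unitInterval, (1 + (α : ℝ)) / 2 ∂(μ.1 : Measure unitInterval)) : ν = μ := by
  have hcont : ∀ ξ : ProbSet, ContinuousOn
      (fun s => ∫ α, avarStep s α ∂(ξ.1 : Measure unitInterval)) (Icc 0 1) := fun ξ =>
    (continuousOn_integral_avarStep ξ).mono fun _ h => h.2
  have hint : ∀ ξ : ProbSet, IntegrableOn
      (fun s => ∫ α, avarStep s α ∂(ξ.1 : Measure unitInterval)) (Ico 0 1) := fun ξ =>
    ((hcont ξ).integrableOn_Icc).mono_set Ico_subset_Icc_self
  rw [← integral_integral_avarStep, ← integral_integral_avarStep] at heq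
  -- Ordered functions with equal integrals agree a.e.; continuity then gives equality on all of
  -- `[0,1)`.
  have hae := (integral_eq_iff_of_ae_le (hint ν) (hint μ)
    ((ae_restrict_mem measurableSet_Ico).mono hle)).1 heq
  have hE := Measure.eqOn_Ico_of_ae_eq volume hae ((hcont ν).mono Ico_subset_Icc_self)
    ((hcont μ).mono Ico_subset_Icc_self)
  refine eq_of_eqOn_T fun s hs => ?_
  refine tendsto_nhds_unique (tendsto_slope_integral_avarStep ν hs.2)
    ((tendsto_slope_integral_avarStep μ hs.2).congr' ?_)
  filter_upwards [Ioo_mem_nhdsGT hs.2] with r hr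
  have h1 := hE hs
  have h2 := hE ⟨hs.1.trans hr.1.le, hr.2⟩
  simp only at h1 h2
  rw [h1, h2]

theorem exists_avar_eq_avarStep (p : ℝ≥0∞) {s : ℝ} (hs : s ∈ Ico (0 : ℝ) 1) :
    ∃ Z : Lp ℝ p (volume : Measure unitInterval), ∀ ν : ProbSet,
      (fun α : unitInterval => avar α Z) =ᵐ[(ν.1 : Measure unitInterval)] avarStep s := by
  have hQ : Monotone ((Ici s).indicator (1 : ℝ → ℝ)) := fun x y hxy => by
    by_cases hx : s ≤ x
    · rw [indicator_of_mem (show x ∈ Ici s from hx),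
        indicator_of_mem (show y ∈ Ici s from hx.trans hxy)]
      simp
    · rw [indicator_of_notMem (show x ∉ Ici s from hx)]
      exact indicator_nonneg (fun _ _ => zero_le_one) _
  obtain ⟨Z, hZ⟩ := exists_avar_eq p hQ (C := 1) fun t _ => by
    by_cases ht : s ≤ t <;> simp [indicator, ht]
  refine ⟨Z, fun ν => ?_⟩
  filter_upwards [ae_lt_one ν] with α hα
  rw [hZ α ⟨α.2.1, hα⟩, integral_indicator_one measurableSet_Ici, measureReal_restrict_apply
    measurableSet_Ici, inter_comm, Ico_inter_Ici, measureReal_def, Real.volume_Ico,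
    ENNReal.toReal_ofReal (sub_nonneg.2 (max_le hα.le hs.2.le))]
  have hpos : 0 < 1 - (α : ℝ) := sub_pos.2 hα
  rcases le_total (α : ℝ) s with h | h
  · rw [avarStep_of_le h, max_eq_right h, inv_mul_eq_div]
  · rw [avarStep_of_ge hs.2 h, max_eq_left h, inv_mul_cancel₀ hpos.ne']

theorem exists_avar_eq_half (p : ℝ≥0∞) :
    ∃ Z : Lp ℝ p (volume : Measure unitInterval), ∀ ν : ProbSet,
      (fun α : unitInterval => avar α Z) =ᵐ[(ν.1 : Measure unitInterval)]
        fun α => (1 + (α : ℝ)) / 2 := by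
  obtain ⟨Z, hZ⟩ := exists_avar_eq p monotone_id (C := 1) fun t ht => by
    rw [id, abs_of_nonneg ht.1]; exact ht.2
  refine ⟨Z, fun ν => ?_⟩
  filter_upwards [ae_lt_one ν] with α hα
  have hpos : 1 - (α : ℝ) ≠ 0 := (sub_pos.2 hα).ne'
  rw [hZ α ⟨α.2.1, hα⟩, integral_Ico_eq_integral_Ioc, ← intervalIntegral.integral_of_le hα.le]
  simp only [id, integral_id]
  field_simp
  ring

/-! ### Compactness and minimality. -/

theorem continuous_integral {f : unitInterval → ℝ} (hf : Continuous f) :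
    Continuous fun ν : ProbabilityMeasure unitInterval => ∫ α, f α ∂(ν : Measure unitInterval) :=
  ProbabilityMeasure.continuous_integral_boundedContinuousFunction
    (BoundedContinuousFunction.mkOfCompact ⟨f, hf⟩)

/-- As `avarStep s 1 = 1` for `s < 1`, the mass at `1` is at most `∫ avarStep s dμ`, which tends to
`0` as `s → 1`. -/
theorem measure_singleton_one_eq_zero {ν : ProbabilityMeasure unitInterval} {μ : ProbSet}
    (hle : ∀ s ∈ Ico (0 : ℝ) 1, ∫ α, avarStep s α ∂(ν : Measure unitInterval) ≤
      ∫ α, avarStep s α ∂(μ.1 : Measure unitInterval)) :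
    (ν : Measure unitInterval) {1} = 0 := by
  have hbound : ∀ s ∈ Ico (0 : ℝ) 1, (ν : Measure unitInterval).real {1} ≤
      ∫ α, avarStep s α ∂(μ.1 : Measure unitInterval) := by
    intro s hs
    refine le_trans ?_ (hle s hs)
    rw [← integral_indicator_one (measurableSet_singleton _)]
    refine integral_mono_of_nonneg (Eventually.of_forall fun α =>
      indicator_nonneg (fun _ _ => zero_le_one) _) (integrable_avarStep ν hs.2.le)
      (Eventually.of_forall fun α => indicator_le' (fun x hx => ?_)
        (fun x _ => avarStep_nonneg hs.2.le x) α)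
    rw [mem_singleton_iff.1 hx, avarStep_of_ge hs.2 (by simpa using hs.2.le)]
    rfl
  have hzero : ∫ α, avarStep 1 α ∂(μ.1 : Measure unitInterval) = 0 := by simp [avarStep]
  have hlim : Tendsto (fun s => ∫ α, avarStep s α ∂(μ.1 : Measure unitInterval))
      (𝓝[<] 1) (𝓝 0) := by
    rw [← hzero]
    exact (continuousOn_integral_avarStep μ 1 self_mem_Iic).mono_left
      (nhdsWithin_mono _ Iio_subset_Iic_self)
  have h0 : (ν : Measure unitInterval).real {1} ≤ 0 := by
    refine ge_of_tendsto hlim ?_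
    filter_upwards [Ico_mem_nhdsLT (zero_lt_one' ℝ)] with s hs using hbound s hs
  exact (measureReal_eq_zero_iff).1 (le_antisymm h0 measureReal_nonneg)

/-- If `{μ}` is a Kusuoka set, then `μ` belongs to every closed Kusuoka set. -/
theorem mem_of_isKusuokaSet_singleton {p : ℝ≥0∞}
    {ρ : Lp ℝ p (volume : Measure unitInterval) → ℝ} {μ : ProbSet}
    (hμ : IsKusuokaSet p ρ {μ}) {M : Set ProbSet} (hM : IsKusuokaSet p ρ M) (hc : IsClosed M) :
    μ ∈ M := by
  have hρ : ∀ Z, ρ Z = ∫ α : unitInterval, avar α Z ∂(μ.1 : Measure unitInterval) := fun Z => by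
    have h := (hμ Z).2
    rw [image_singleton] at h
    exact h.unique isLUB_singleton
  -- `M` is closed only in `𝔓`, which is not compact; mass may escape to `1`.
  set K : Set (ProbabilityMeasure unitInterval) := closure (Subtype.val '' M)
  have hK : IsCompact K := isClosed_closure.isCompact
  set F : ProbabilityMeasure unitInterval → ℝ := fun ν =>
    ∫ α : unitInterval, (1 + (α : ℝ)) / 2 ∂(ν : Measure unitInterval)
  have hF : Continuous F := continuous_integral (by fun_prop)
  have hKle : ∀ ν ∈ K, ∀ s ∈ Ico (0 : ℝ) 1, ∫ α, avarStep s α ∂(ν : Measure unitInterval) ≤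
      ∫ α, avarStep s α ∂(μ.1 : Measure unitInterval) := by
    intro ν hν s hs
    refine closure_minimal (t := {ν : ProbabilityMeasure unitInterval |
      ∫ α, avarStep s α ∂(ν : Measure unitInterval) ≤
        ∫ α, avarStep s α ∂(μ.1 : Measure unitInterval)}) ?_
      (isClosed_le (continuous_integral (continuous_avarStep hs.2)) continuous_const) hν
    rintro _ ⟨ξ, hξ, rfl⟩
    obtain ⟨Z, hZ⟩ := exists_avar_eq_avarStep p hs
    have h := (hM Z).2.1 (mem_image_of_mem _ hξ)
    rw [hρ, integral_congr_ae (hZ μ)] at h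
    simp only [integral_congr_ae (hZ ξ)] at h
    exact h
  -- The supremum over `M` for `Z(ω) = ω` lies in the compact set `F '' K`, so it is attained on
  -- `K`.
  obtain ⟨ν, hν, hFν⟩ : F μ.1 ∈ F '' K := by
    obtain ⟨Z, hZ⟩ := exists_avar_eq_half p
    have h := (hM Z).2
    rw [hρ, integral_congr_ae (hZ μ)] at h
    refine (hK.image hF).isClosed.closure_subset_iff.2 ?_ (h.mem_closure h.nonempty)
    rintro _ ⟨ξ, hξ, rfl⟩
    exact ⟨ξ.1, subset_closure (mem_image_of_mem _ hξ), (integral_congr_ae (hZ ξ)).symm⟩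
  have hν1 := measure_singleton_one_eq_zero (hKle ν hν)
  have hνμ : (⟨ν, hν1⟩ : ProbSet) = μ := eq_of_integral_avarStep_le (hKle ν hν) hFν
  -- Being closed in `𝔓`, `M` is the trace of `K` on `𝔓`.
  rw [← hc.closure_eq, closure_subtype, ← hνμ]
  exact hν

end Kusuoka

end

theorem mainTheorem8 (p q : ℝ≥0∞) (hp : 1 ≤ p) (hp_top : p ≠ ∞) (hpq : p⁻¹ + q⁻¹ = 1)
    (σ : ℝ → ℝ) (hσ : Kusuoka.IsSpectral σ)
    (hσq : MemLp σ q ((volume : Measure ℝ).restrict (Ico (0 : ℝ) 1))) :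
    (∀ Z : Lp ℝ p (volume : Measure unitInterval),
      IntegrableOn (fun t => σ t * Kusuoka.quantile Z t) (Ico (0 : ℝ) 1)) ∧
    ∃ μ : Kusuoka.ProbSet,
      -- `μ = 𝕋⁻¹σ`: it is the one and only element of `𝔓` that `𝕋` maps to `σ`
      (∀ ν : Kusuoka.ProbSet, EqOn (Kusuoka.T ν) σ (Ico (0 : ℝ) 1) ↔ ν = μ) ∧
      -- its distribution function
      (∀ α : unitInterval, (μ.1 : Measure unitInterval).real (Iic α) =
        (1 - (α : ℝ)) * σ α + ∫ t in Ico (0 : ℝ) (α : ℝ), σ t) ∧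
      -- the minimal Kusuoka set of `ρ_σ` is `{μ}`
      (∀ M : Set Kusuoka.ProbSet,
        Kusuoka.IsMinimalKusuokaSet p (Kusuoka.spectralRisk p σ) M ↔ M = {μ}) := by
  have hμ := Kusuoka.isKusuokaSet_singleton hp hpq hσq hσ.T_invT
  refine ⟨Kusuoka.integrableOn_mul_quantile hpq hσq, hσ.invT, fun ν => ⟨fun h => ?_, ?_⟩,
    hσ.invT_real_Iic, fun M => ⟨fun h => ?_, ?_⟩⟩
  · exact Kusuoka.eq_of_eqOn_T (h.trans hσ.T_invT.symm)
  · rintro rfl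
    exact hσ.T_invT
  · exact (h.2.2 _ hμ isClosed_singleton).antisymm
      (singleton_subset_iff.2 (Kusuoka.mem_of_isKusuokaSet_singleton hμ h.1 h.2.1))
  · rintro rfl
    exact ⟨hμ, isClosed_singleton, fun M' hM' hc =>
      singleton_subset_iff.2 (Kusuoka.mem_of_isKusuokaSet_singleton hμ hM' hc)⟩
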